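/- Identify subsets of $\omega$ with elements of $2^\omega$, and let $\mu$ be the uniform (fair-coin) measure on $2^\omega$. A family $(\mathcal U_i)_{i\in I}$ ($I=\omega$ or $\omega^2$) of subsets of $2^\omega$ is uniformly $\Sigma^0_1$ if there is a computable relation $R$ with $X\in\mathcal U_i\iff\exists l\,R(i,X\upharpoonright l)$; a sequence $(\mathcal S_m)_{m\in\omega}$ is uniformly $\Pi^0_2$ if $\mathcal S_m=\bigcap_n\mathcal V^m_n$ for some uniformly $\Sigma^0_1$ family $(\mathcal V^m_n)_{m,n\in\omega}$; and relations $P_0(Y,Z),P_1(Y,Z),\ldots$ on $2^\omega$ are uniformly $\Pi^0_1$ if there is a computable relation $\Theta$ with $P_k(Y,Z)\iff\forall l\,\Theta(k,Y\upharpoonright l,Z\upharpoonright l)$. Write $P_k(Y)=\{Z:P_k(Y,Z)\}$. A set $Z$ is $1$-random if $Z\notin\bigcap_n\mathcal U_n$ for every uniformly $\Sigma^0_1$ sequence $(\mathcal U_n)_{n\in\omega}$ with $\mu(\mathcal U_n)\le 2^{-n}$ for all $n$. Let $W_e$ be the $e$-th c.e. set, with its standard enumeration $W_e[0]=\emptyset\subseteq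 W_e[1]\subseteq\cdots$ by finite stages. A set $A\subseteq\omega$ is promptly simple if it is c.e. and coinfinite, and there are a computable function $f$ and a computable enumeration $A[0]\subseteq A[1]\subseteq\cdots$ of $A$ by finite sets such that for each $e$, if $W_e$ is infinite, then there are $n$ and $s$ with $n\in W_e[s]\setminus W_e[s-1]$ and $n\in A[f(s)]$. Theorem. Let $\mathcal S_0,\mathcal S_1,\ldots$ be uniformly $\Pi^0_2$ classes with $\mu(\mathcal S_m)=0$ for all $m$, and let $P_0(Y,Z),P_1(Y,Z),\ldots$ be uniformly $\Pi^0_1$ relations on $2^\omega$. Let $\mathcal D$ be the class of all $Y\in 2^\omega$ for which there are numbers $k,m$ and a $1$-random set $Z$ such that $Z\in P_k(Y)\subseteq\mathcal S_m$. Then there is a promptly simple set $A$ such that $A\le_{\mathrm T}Y$ for every $Y\in\mathcal D$. -/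

import Mathlib

namespace AlgRandom

/-- Cantor space `2^ω`. A set of natural numbers is identified with its characteristic function. -/
abbrev Cantor : Type := ℕ → Bool

/-- `restrict X n` is the initial segment of `X` of length `n`, as a binary string. -/
def restrict (X : Cantor) (n : ℕ) : List Bool := (List.range n).map X

/-- The uniform ("fair coin") probability measure on Cantor space. -/
noncomputable def coinMeasure : MeasureTheory.Measure Cantor :=
  MeasureTheory.Measure.infinitePi fun _ : ℕ => (PMF.uniformOfFintype Bool).toMeasure

/-- A family of classes is uniformly `Σ⁰₁` if for some computable relation `R` we have
`X ∈ U i ↔ ∃ l, R i (X ↾ l)` for all `i` and `X`. -/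
def UniformlySigma01 {ι : Type} [Primcodable ι] (U : ι → Set Cantor) : Prop :=
  ∃ R : ι → List Bool → Prop,
    ComputablePred (fun p : ι × List Bool => R p.1 p.2) ∧
      ∀ (i : ι) (X : Cantor), X ∈ U i ↔ ∃ l : ℕ, R i (restrict X l)

/-- A sequence of classes is uniformly `Π⁰₂` if its `m`-th class is `⋂ n, V (m, n)`, where
the classes `V (m, n)` are uniformly `Σ⁰₁`. -/
def UniformlyPi02 (S : ℕ → Set Cantor) : Prop :=
  ∃ V : ℕ × ℕ → Set Cantor, UniformlySigma01 V ∧ ∀ m : ℕ, S m = ⋂ n : ℕ, V (m, n)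

/-- A sequence of binary relations on Cantor space is uniformly `Π⁰₁` if for some computable
relation `Θ` we have `P k Y Z ↔ ∀ l, Θ k (Y ↾ l) (Z ↾ l)` for all `k`, `Y` and `Z`. -/
def UniformlyPi01Rel (P : ℕ → Cantor → Cantor → Prop) : Prop :=
  ∃ Θ : ℕ → List Bool → List Bool → Prop,
    ComputablePred (fun p : ℕ × List Bool × List Bool => Θ p.1 p.2.1 p.2.2) ∧
      ∀ (k : ℕ) (Y Z : Cantor), P k Y Z ↔ ∀ l : ℕ, Θ k (restrict Y l) (restrict Z l)

/-- A Martin-Löf test: uniformly `Σ⁰₁` classes `U n` of measure at most `2⁻ⁿ`. -/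
def IsMartinLofTest (U : ℕ → Set Cantor) : Prop :=
  UniformlySigma01 U ∧ ∀ n : ℕ, coinMeasure (U n) ≤ (2⁻¹ : ENNReal) ^ n

/-- `Z` is `1`-random (Martin-Löf random) if it passes every Martin-Löf test. -/
def IsOneRandom (Z : Cantor) : Prop :=
  ∀ U : ℕ → Set Cantor, IsMartinLofTest U → Z ∉ ⋂ n : ℕ, U n

/-- `A ≤_T B` for elements of Cantor space. -/
def TuringLE (A B : Cantor) : Prop :=
  TuringReducible (fun n : ℕ => Part.some (A n).toNat) (fun n : ℕ => Part.some (B n).toNat)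

/-- The `e`-th c.e. set `W_e`: the domain of the `e`-th partial computable function. -/
def W (e : ℕ) : Set ℕ :=
  {n | ((Denumerable.ofNat Nat.Partrec.Code e).eval n).Dom}

/-- The stage `s` approximation `W_e[s]`: the inputs on which the `e`-th program halts within the
bound `s`. It is a finite subset of `{0, …, s - 1}`; in particular `W_e[0] = ∅`. -/
def WStage (e s : ℕ) : Set ℕ :=
  {n | (Nat.Partrec.Code.evaln s (Denumerable.ofNat Nat.Partrec.Code e) n).isSome}

/-- A computable enumeration of `A`: a computable increasing sequence of finite sets, each given
by an explicit list of its elements, with union `A`. -/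
def IsComputableEnumeration (A : Cantor) (E : ℕ → List ℕ) : Prop :=
  Computable E ∧ (∀ s : ℕ, E s ⊆ E (s + 1)) ∧ ∀ n : ℕ, A n = true ↔ ∃ s : ℕ, n ∈ E s

/-- `A` is promptly simple. As `W_e[0] = ∅`, the truncated `s - 1` at `s = 0` is harmless. -/
def IsPromptlySimple (A : Cantor) : Prop :=
  REPred (fun n : ℕ => A n = true) ∧
  {n : ℕ | A n = false}.Infinite ∧
  ∃ (f : ℕ → ℕ) (E : ℕ → List ℕ), Computable f ∧ IsComputableEnumeration A E ∧
    ∀ e : ℕ, (W e).Infinite →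
      ∃ n s : ℕ, n ∈ WStage e s \ WStage e (s - 1) ∧ n ∈ E (f s)

/-- The class `𝒟` of all `Y` such that `Z ∈ P_k(Y) ⊆ S_m` for some `k`, `m` and some `1`-random
`Z`, where `P_k(Y) = {Z | P_k(Y, Z)}`. -/
def classD (S : ℕ → Set Cantor) (P : ℕ → Cantor → Cantor → Prop) : Set Cantor :=
  {Y | ∃ (k m : ℕ) (Z : Cantor), IsOneRandom Z ∧ Z ∈ {X | P k Y X} ∧ {X | P k Y X} ⊆ S m}

end AlgRandom

/-! The set `A` is built by a cost-function construction that depends only on the null classes. Let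
`G(m, x)` be the intersection of `V(m, 0), …, V(m, x)`, with approximation `G(m, x)[p]` by strings
of length `p`. Requirement `e` may put `x` into `A` at stage `p = ⟨x, s⟩` if `x` enters `W e` at
`s`, `x ≥ 2e`, and `G(m, x)[p]` has measure at most `2⁻ᵉ` for every `m ≤ e`. It acts at the first
opportunity and only then.

Since `S m` is null, the measure of `G(m, x)` tends to `0` in `x`. So an infinite `W e` has an
element cheap enough whenever it appears, and enumeration is prompt (`exists_candidate`). The bound
`x ≥ 2e` keeps `A` coinfinite.

Let `Z ∈ P k Y ⊆ S m` with `Z` 1-random. The classes `G(m, x)[p]` charged by actions form a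
Martin-Löf test (`coinMeasure_enumerationTest_le`), so from some stage `b` on, `Z` avoids all of
them. By compactness (`exists_stage_subset`), `Y` can find a stage `s` at which every string not
refuted as a member of `P k Y` is already in `G(m, x)[s]`. Then `Z ∈ G(m, x)[s]`, so `x` cannot
enter `A` at any stage from `max b s` on (`turingLE_enumeratedSet`). -/

namespace AlgRandom

/-! ### Closure properties of computable predicates and functions -/

section Computability

variable {α β : Type*} [Primcodable α] [Primcodable β]

theorem ComputablePred.comp {p : β → Prop} (hp : ComputablePred p) {f : α → β}
    (hf : Computable f) : ComputablePred fun a => p (f a) := by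
  classical
  exact (hp.decide.comp hf).computablePred

theorem ComputablePred.and {p q : α → Prop} (hp : ComputablePred p) (hq : ComputablePred q) :
    ComputablePred fun a => p a ∧ q a := by
  classical
  refine Computable.computablePred (p := fun a => p a ∧ q a) ?_
  exact (Primrec.and.to_comp.comp hp.decide hq.decide).of_eq fun a => by simp

theorem ComputablePred.imp {p q : α → Prop} (hp : ComputablePred p) (hq : ComputablePred q) :
    ComputablePred fun a => p a → q a :=
  (ComputablePred.and hp hq.not).not.of_eq fun a => by tauto

theorem ComputablePred.forall_lt {p : α → ℕ → Prop} {f : α → ℕ}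
    (hp : ComputablePred fun x : α × ℕ => p x.1 x.2) (hf : Computable f) :
    ComputablePred fun a => ∀ i < f a, p a i := by
  classical
  have key : Computable fun a =>
      Nat.rec (motive := fun _ => Bool) true (fun i b => b && decide (p a i)) (f a) := by
    refine Computable.nat_rec hf (Computable.const true)
      (Primrec.and.to_comp.comp (Computable.snd.comp Computable.snd)
        (hp.decide.comp (Computable.pair Computable.fst
          (Computable.fst.comp Computable.snd)))).to₂
  refine Computable.computablePred (p := fun a => ∀ i < f a, p a i) (key.of_eq fun a => ?_)
  induction f a with
  | zero => simp
  | succ n ih =>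
    simp only [ih, ← Bool.decide_and, Nat.forall_lt_succ_right]

theorem ComputablePred.exists_lt {p : α → ℕ → Prop} {f : α → ℕ}
    (hp : ComputablePred fun x : α × ℕ => p x.1 x.2) (hf : Computable f) :
    ComputablePred fun a => ∃ i < f a, p a i :=
  (ComputablePred.forall_lt (p := fun a i => ¬p a i) hp.not hf).not.of_eq fun a => by
    push Not; rfl

theorem ComputablePred.le {f g : α → ℕ} (hf : Computable f) (hg : Computable g) :
    ComputablePred fun a => f a ≤ g a :=
  ComputablePred.comp (p := fun x : ℕ × ℕ => x.1 ≤ x.2)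
    (PrimrecPred.computablePred Primrec.nat_le) (hf.pair hg)

theorem ComputablePred.eq [DecidableEq β] {f g : α → β} (hf : Computable f) (hg : Computable g) :
    ComputablePred fun a => f a = g a :=
  ComputablePred.comp (p := fun x : β × β => x.1 = x.2)
    (PrimrecPred.computablePred Primrec.eq) (hf.pair hg)

theorem Computable.map_range {f : α → ℕ} {g : α → ℕ → β} (hf : Computable f)
    (hg : Computable₂ g) : Computable fun a => (List.range (f a)).map (g a) := by
  have key : Computable fun a =>
      Nat.rec (motive := fun _ => List β) [] (fun i l => l ++ [g a i]) (f a) :=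
    Computable.nat_rec hf (Computable.const [])
      (Computable.list_concat.comp (Computable.snd.comp Computable.snd)
        (hg.comp Computable.fst (Computable.fst.comp Computable.snd))).to₂
  refine key.of_eq fun a => ?_
  induction f a with
  | zero => rfl
  | succ n ih => simp [ih, List.range_succ]

theorem Computable.filter_range {f : α → ℕ} {p : α → ℕ → Prop} [∀ a, DecidablePred (p a)]
    (hf : Computable f) (hp : ComputablePred fun x : α × ℕ => p x.1 x.2) :
    Computable fun a => (List.range (f a)).filter (p a ·) := by
  have key : Computable fun a => Nat.rec (motive := fun _ => List ℕ) []
      (fun i l => bif decide (p a i) then l ++ [i] else l) (f a) :=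
    Computable.nat_rec hf (Computable.const [])
      (Computable.cond
        (hp.decide.comp (Computable.pair Computable.fst (Computable.fst.comp Computable.snd)))
        (Computable.list_concat.comp (Computable.snd.comp Computable.snd)
          (Computable.fst.comp Computable.snd))
        (Computable.snd.comp Computable.snd)).to₂
  refine key.of_eq fun a => ?_
  induction f a with
  | zero => rfl
  | succ n ih =>
    simp only [ih, List.range_succ, List.filter_append]
    by_cases h : p a n <;> simp [h]

theorem Computable.count {f : α → ℕ} {p : α → ℕ → Prop} [∀ a, DecidablePred (p a)]
    (hf : Computable f) (hp : ComputablePred fun x : α × ℕ => p x.1 x.2) :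
    Computable fun a => Nat.count (p a) (f a) :=
  (Computable.list_length.comp (Computable.filter_range hf hp)).of_eq fun a => by
    rw [Nat.count, List.countP_eq_length_filter]

theorem ComputablePred.mem_list {f : α → ℕ} {g : α → List ℕ} (hf : Computable f)
    (hg : Computable g) : ComputablePred fun a => f a ∈ g a :=
  (ComputablePred.exists_lt (p := fun a i => (g a)[i]? = some (f a))
    (ComputablePred.eq (Computable.list_getElem?.comp (hg.comp Computable.fst) Computable.snd)
      (Computable.option_some.comp (hf.comp Computable.fst)))
    (Computable.list_length.comp hg)).of_eq fun a => by
      rw [List.mem_iff_getElem?]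
      exact ⟨fun ⟨i, _, h⟩ => ⟨i, h⟩, fun ⟨i, h⟩ => ⟨i, (List.getElem?_eq_some_iff.1 h).1, h⟩⟩

theorem REPred.exists_nat {p : α → ℕ → Prop} (hp : ComputablePred fun x : α × ℕ => p x.1 x.2) :
    REPred fun a => ∃ n, p a n := by
  classical
  have h : Partrec fun a => Nat.rfind fun n => Part.some (decide (p a n)) :=
    Partrec.rfind hp.decide.partrec
  refine h.dom_re.of_eq fun a => (Nat.rfind_dom' (p := fun n => Part.some (decide (p a n)))).trans ?_
  simp

theorem computable_two_pow : Computable fun n : ℕ => 2 ^ n :=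
  (Computable.nat_rec Computable.id (Computable.const 1)
    (Primrec.nat_mul.to_comp.comp (Computable.snd.comp Computable.snd)
      (Computable.const 2)).to₂).of_eq fun n => by
    induction n with
    | zero => rfl
    | succ n ih => simp only [id, pow_succ] at ih ⊢; rw [ih]

theorem computable_testBit : Computable₂ Nat.testBit := by
  have h : ComputablePred fun x : ℕ × ℕ => x.1 / 2 ^ x.2 % 2 = 1 :=
    ComputablePred.eq (Primrec.nat_mod.to_comp.comp
      (Primrec.nat_div.to_comp.comp Computable.fst (computable_two_pow.comp Computable.snd))
      (Computable.const 2)) (Computable.const 1)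
  exact h.decide.of_eq fun x => by rw [Nat.testBit_eq_decide_div_mod_eq]

/-- The binary string of length `p` formed by the last `p` binary digits of `i`. -/
def bitString (p i : ℕ) : List Bool := restrict i.testBit p

theorem computable_bitString : Computable₂ bitString :=
  Computable.map_range Computable.fst
    (computable_testBit.comp (Computable.snd.comp Computable.fst) Computable.snd).to₂

theorem computable_take : Computable₂ (List.take : ℕ → List Bool → List Bool) :=
  Primrec.list_take.to_comp

end Computability

/-! ### Computation relative to an oracle -/

section Oracle

variable {O : Set (ℕ →. ℕ)} {f g h : ℕ → ℕ}

theorem _root_.Computable.natRecursiveIn (hf : Computable f) :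
    Nat.RecursiveIn O fun n => Part.some (f n) :=
  Nat.Partrec.recursiveIn (Partrec.nat_iff.1 hf.partrec)

theorem _root_.Nat.RecursiveIn.comp_total (hf : Nat.RecursiveIn O fun n => Part.some (f n))
    (hg : Nat.RecursiveIn O fun n => Part.some (g n)) :
    Nat.RecursiveIn O fun n => Part.some (f (g n)) :=
  (Nat.RecursiveIn.comp hf hg).of_eq fun _ => Part.bind_some _ _

theorem _root_.Nat.RecursiveIn.pair_total (hf : Nat.RecursiveIn O fun n => Part.some (f n))
    (hg : Nat.RecursiveIn O fun n => Part.some (g n)) :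
    Nat.RecursiveIn O fun n => Part.some (Nat.pair (f n) (g n)) :=
  (Nat.RecursiveIn.pair hf hg).of_eq fun n => by
    change ((Part.some (f n)).map Nat.pair).bind (fun u => (Part.some (g n)).map u) = _
    simp

theorem _root_.Nat.RecursiveIn.iterate_total {a : ℕ}
    (hf : Nat.RecursiveIn O fun n => Part.some (f n)) :
    Nat.RecursiveIn O fun n => Part.some
      (Nat.rec (motive := fun _ => ℕ) a (fun i b => f (Nat.pair i b)) n) := by
  have hstep : Nat.RecursiveIn O fun n => Part.some (f n.unpair.2) :=
    hf.comp_total (Computable.snd.comp Computable.unpair).natRecursiveIn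
  have hrec := Nat.RecursiveIn.prec (Computable.const a).natRecursiveIn hstep
  -- `Nat.RecursiveIn.prec` recurses on the second component of a pair; the parameter in the first
  -- component is a dummy `0`.
  have harg : Computable fun n : ℕ => Nat.pair 0 n :=
    Primrec₂.natPair.to_comp.comp (Computable.const 0) Computable.id
  refine (Nat.RecursiveIn.comp hrec harg.natRecursiveIn).of_eq fun n => ?_
  rw [Part.bind_eq_bind, Part.bind_some]
  simp only [Nat.unpair_pair]
  induction n with
  | zero => rfl
  | succ n ih =>
    simp only [Part.bind_eq_bind] at ih ⊢
    rw [ih, Part.bind_some]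

theorem _root_.Nat.RecursiveIn.find_total {p : ℕ → ℕ → Prop} [∀ x, DecidablePred (p x)]
    (hf : Nat.RecursiveIn O fun n => Part.some (f n))
    (hp : ∀ x s, f (Nat.pair x s) = 0 ↔ p x s) (hex : ∀ x, ∃ s, p x s) :
    Nat.RecursiveIn O fun x => Part.some (Nat.find (hex x)) := by
  refine (Nat.RecursiveIn.rfind hf).of_eq fun x => ?_
  refine Part.eq_some_iff.2 (Nat.mem_rfind.2 ⟨?_, fun {m} hm => ?_⟩)
  · simpa [hp] using Nat.find_spec (hex x)
  · simpa [hp] using Nat.find_min (hex x) hm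

/-- The initial segments of an oracle are computable in the oracle. -/
theorem recursiveIn_restrict (Y : Cantor) :
    Nat.RecursiveIn {fun n : ℕ => Part.some (Y n).toNat}
      fun n => Part.some (Encodable.encode (restrict Y n)) := by
  have hY : Nat.RecursiveIn {fun n : ℕ => Part.some (Y n).toNat}
      fun n => Part.some (Y n).toNat := Nat.RecursiveIn.oracle _ (Set.mem_singleton _)
  -- The input pairs the oracle's answer with the code of the segment built so far. The default `[]`
  -- is never used on genuine codes.
  let g : ℕ → ℕ := fun n => Encodable.encode
    ((Encodable.decode n.unpair.2 : Option (List Bool)).getD [] ++ [decide (n.unpair.1 = 1)])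
  have hg : Computable g := Computable.encode.comp (Computable.list_concat.comp
    (Computable.option_getD (Computable.decode.comp (Computable.snd.comp Computable.unpair))
      (Computable.const []))
    (ComputablePred.eq (Computable.fst.comp Computable.unpair) (Computable.const 1)).decide)
  have hstep := hg.natRecursiveIn.comp_total (Nat.RecursiveIn.pair_total
    (hY.comp_total (Computable.fst.comp Computable.unpair).natRecursiveIn)
    (Computable.snd.comp Computable.unpair).natRecursiveIn)
  refine (hstep.iterate_total (a := Encodable.encode ([] : List Bool))).of_eq fun n => ?_
  congr 1
  induction n with
  | zero => rfl
  | succ n ih => simp only [ih]; simp [g, restrict, List.range_succ]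

/-- `A ≤_T Y` if membership in `A` is decided by any stage satisfying a `Y`-computable condition,
and such stages always exist. -/
theorem turingLE_of_search {A Y : Cantor} {C : ℕ → ℕ → List Bool → Prop} {D : ℕ → ℕ → Prop}
    (hC : ComputablePred fun x : (ℕ × ℕ) × List Bool => C x.1.1 x.1.2 x.2)
    (hD : ComputablePred fun x : ℕ × ℕ => D x.1 x.2)
    (hex : ∀ x, ∃ s, C x s (restrict Y s))
    (hA : ∀ x s, C x s (restrict Y s) → (A x = true ↔ D x s)) : TuringLE A Y := by
  classical
  let c : ℕ → (ℕ × ℕ) × List Bool := fun n =>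
    (n.unpair.1.unpair, (Encodable.decode n.unpair.2 : Option (List Bool)).getD [])
  have hc : Computable c :=
    (Computable.unpair.comp (Computable.fst.comp Computable.unpair)).pair
      (Computable.option_getD (Computable.decode.comp (Computable.snd.comp Computable.unpair))
        (Computable.const []))
  -- The value `0` stands for success, since unbounded search looks for a zero.
  let g : ℕ → ℕ := fun n => bif decide (C (c n).1.1 (c n).1.2 (c n).2) then 0 else 1
  have hg : Computable g := Computable.cond (ComputablePred.comp hC hc).decide
    (Computable.const 0) (Computable.const 1)
  have hcond := hg.natRecursiveIn.comp_total (Nat.RecursiveIn.pair_total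
    Computable.id.natRecursiveIn
    ((recursiveIn_restrict Y).comp_total (Computable.snd.comp Computable.unpair).natRecursiveIn))
  have hfind := hcond.find_total (p := fun x s => C x s (restrict Y s))
    (fun x s => by simp [g, c, Bool.cond_decide]) hex
  let d : ℕ → ℕ := fun n => bif decide (D n.unpair.1 n.unpair.2) then 1 else 0
  have hd : Computable d := Computable.cond (hD.decide.comp Computable.unpair)
    (Computable.const 1) (Computable.const 0)
  refine RecursiveIn.iff_nat.2 ?_
  refine (hd.natRecursiveIn.comp_total
    (Nat.RecursiveIn.pair_total Computable.id.natRecursiveIn hfind)).of_eq fun x => ?_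
  have := hA x _ (Nat.find_spec (hex x))
  by_cases h : D x (Nat.find (hex x))
  · simp [d, h, this.2 h]
  · have : A x = false := by simpa [h] using this
    simp [d, h, this]

end Oracle

end AlgRandom

namespace AlgRandom

open MeasureTheory Filter Topology

/-! ### Binary strings coded by numbers -/

section Strings

theorem length_restrict (X : Cantor) (n : ℕ) : (restrict X n).length = n := by simp [restrict]

theorem take_restrict (X : Cantor) {l n : ℕ} (h : l ≤ n) :
    (restrict X n).take l = restrict X l := by
  simp [restrict, ← List.map_take, List.take_range, h]

theorem restrict_eq_iff {X Y : Cantor} {n : ℕ} :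
    restrict X n = restrict Y n ↔ ∀ i < n, X i = Y i := by
  simp [restrict]

/-- Together with `bitString_injOn`, this lets quantification over strings of length `p`, and
counting them, run over the numbers below `2 ^ p`. -/
theorem exists_bitString_eq (X : Cantor) (p : ℕ) : ∃ i < 2 ^ p, bitString p i = restrict X p := by
  refine ⟨Nat.ofBits fun j : Fin p => X j, Nat.ofBits_lt_two_pow _, restrict_eq_iff.2 ?_⟩
  intro j hj
  exact Nat.testBit_ofBits_lt _ j hj

theorem bitString_injOn {p i j : ℕ} (hi : i < 2 ^ p) (hj : j < 2 ^ p)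
    (h : bitString p i = bitString p j) : i = j := by
  refine Nat.eq_of_testBit_eq fun k => ?_
  rcases lt_or_ge k p with hk | hk
  · exact restrict_eq_iff.1 h k hk
  · have := Nat.pow_le_pow_right two_pos hk
    rw [Nat.testBit_lt_two_pow (by lia), Nat.testBit_lt_two_pow (by lia)]

end Strings

/-! ### Coin measure and compactness of Cantor space -/

section Measure

theorem continuous_restrict [TopologicalSpace (List Bool)] [DiscreteTopology (List Bool)] (n : ℕ) :
    Continuous fun X : Cantor => restrict X n := by
  refine IsLocallyConstant.continuous ((IsLocallyConstant.iff_exists_open _).2 fun X => ?_)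
  refine ⟨⋂ i ∈ Finset.range n, {Z | Z i = X i}, ?_, by simp, fun Z hZ => ?_⟩
  · refine isOpen_biInter_finset fun i _ => ?_
    exact (isOpen_discrete ({X i} : Set Bool)).preimage (continuous_apply (A := fun _ => Bool) i)
  · exact restrict_eq_iff.2 fun i hi => by simpa using Set.mem_iInter₂.1 hZ i (by simpa using hi)

theorem isClopen_restrict (Q : List Bool → Prop) (n : ℕ) :
    IsClopen {X : Cantor | Q (restrict X n)} := by
  let _ : TopologicalSpace (List Bool) := ⊥
  have : DiscreteTopology (List Bool) := ⟨rfl⟩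
  exact (isClopen_discrete {σ | Q σ}).preimage (continuous_restrict n)

theorem measurableSet_restrict (Q : List Bool → Prop) (n : ℕ) :
    MeasurableSet {X : Cantor | Q (restrict X n)} :=
  (isClopen_restrict Q n).isOpen.measurableSet

instance : IsProbabilityMeasure coinMeasure := by
  unfold coinMeasure; infer_instance

theorem coinMeasure_cylinder (Y : Cantor) (n : ℕ) :
    coinMeasure {X | restrict X n = restrict Y n} = (2⁻¹ : ENNReal) ^ n := by
  have : {X : Cantor | restrict X n = restrict Y n} =
      Set.pi (Finset.range n) fun i => {Y i} := by
    ext X; simp [restrict_eq_iff, Set.mem_pi]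
  rw [this, coinMeasure, Measure.infinitePi_pi _ fun i _ => MeasurableSet.singleton _]
  simp

open Classical in
theorem coinMeasure_restrict (Q : List Bool → Prop) (n : ℕ) :
    coinMeasure {X | Q (restrict X n)} =
      Nat.count (fun i => Q (bitString n i)) (2 ^ n) * (2⁻¹ : ENNReal) ^ n := by
  have : {X : Cantor | Q (restrict X n)} =
      ⋃ i ∈ (Finset.range (2 ^ n)).filter fun i => Q (bitString n i),
        {X | restrict X n = restrict i.testBit n} := by
    ext X
    simp only [Set.mem_ofPred_eq, Set.mem_iUnion, Finset.mem_filter, Finset.mem_range, exists_prop]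
    constructor
    · intro h
      obtain ⟨i, hi, hX⟩ := exists_bitString_eq X n
      exact ⟨i, ⟨hi, hX ▸ h⟩, hX.symm⟩
    · rintro ⟨i, ⟨_, hQ⟩, hX⟩
      rw [hX]; exact hQ
  rw [this, measure_biUnion_finset]
  · simp only [coinMeasure_cylinder, Finset.sum_const, nsmul_eq_mul, Nat.count_eq_card_filter_range]
  · intro i hi j hj hij
    refine Set.disjoint_left.2 fun X hX hX' => hij ?_
    simp only [Finset.coe_filter, Finset.mem_range, Set.mem_ofPred_eq] at hi hj hX hX'
    exact bitString_injOn hi.1 hj.1 (hX.symm.trans hX')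
  · exact fun i _ => measurableSet_restrict (fun σ => σ = restrict i.testBit n) n

open Classical in
-- Clearing denominators turns a measure bound into a decidable inequality between natural numbers,
-- the form used in `Candidate`.
theorem coinMeasure_restrict_le_iff (Q : List Bool → Prop) (n e : ℕ) :
    coinMeasure {X | Q (restrict X n)} ≤ (2⁻¹ : ENNReal) ^ e ↔
      Nat.count (fun i => Q (bitString n i)) (2 ^ n) * 2 ^ e ≤ 2 ^ n := by
  rw [coinMeasure_restrict, ← ENNReal.inv_pow, ← ENNReal.inv_pow, ← div_eq_mul_inv,
    ENNReal.div_le_iff (by simp) (by simp), mul_comm (_⁻¹), ← div_eq_mul_inv,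
    ENNReal.le_div_iff_mul_le (by simp) (by simp)]
  exact_mod_cast Iff.rfl

/-- Compactness: a `Π⁰₁` class contained in a `Σ⁰₁` class is so at some finite stage. -/
theorem exists_stage_subset {C V : ℕ → List Bool → Prop}
    (hC : ∀ X : Cantor, Antitone fun s => C s (restrict X s))
    (hV : ∀ X : Cantor, Monotone fun s => V s (restrict X s))
    (h : ∀ X : Cantor, (∀ s, C s (restrict X s)) → ∃ s, V s (restrict X s)) :
    ∃ s, ∀ X : Cantor, C s (restrict X s) → V s (restrict X s) := by
  by_contra! hcon
  -- The counterexamples at stage `s` form a decreasing sequence of nonempty clopen sets; a common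
  -- point contradicts `h`.
  have hne : (⋂ s, {X : Cantor | C s (restrict X s) ∧ ¬V s (restrict X s)}).Nonempty := by
    refine IsCompact.nonempty_iInter_of_sequence_nonempty_isCompact_isClosed _ ?_ hcon ?_ ?_
    · exact fun s X hX => ⟨hC X s.le_succ hX.1, fun h => hX.2 (hV X s.le_succ h)⟩
    · exact (isClopen_restrict (fun σ => C 0 σ ∧ ¬V 0 σ) 0).isClosed.isCompact
    · exact fun s => (isClopen_restrict (fun σ => C s σ ∧ ¬V s σ) s).isClosed
  obtain ⟨X, hX⟩ := hne
  rw [Set.mem_iInter] at hX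
  obtain ⟨s, hs⟩ := h X fun s => (hX s).1
  exact (hX s).2 hs

end Measure

end AlgRandom

/-! ### The construction of the promptly simple set -/

namespace AlgRandom

open MeasureTheory Filter Topology

/-- The string `σ` witnesses membership of its extensions in the first `x + 1` of the `Σ⁰₁` classes
`V (m, 0), V (m, 1), …` given by `R`. -/
def Covered (R : ℕ × ℕ → List Bool → Prop) (m x : ℕ) (σ : List Bool) : Prop :=
  ∀ i < x + 1, ∃ l < σ.length + 1, R (m, i) (σ.take l)

/-- The strings `τ`, `σ` do not refute `P k Y Z` for `Y` extending `τ` and `Z` extending `σ`. -/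
def Unrefuted (Θ : ℕ → List Bool → List Bool → Prop) (k : ℕ) (τ σ : List Bool) : Prop :=
  ∀ l < σ.length + 1, Θ k (τ.take l) (σ.take l)

open Classical in
/-- At stage `p = ⟨x, s⟩` the number `x` has just entered `W e`, is at least `2 * e`, and its
enumeration into `A` costs at most `2⁻ᵉ`. -/
def Candidate (R : ℕ × ℕ → List Bool → Prop) (e p : ℕ) : Prop :=
  p.unpair.1 ∈ WStage e p.unpair.2 \ WStage e (p.unpair.2 - 1) ∧ 2 * e ≤ p.unpair.1 ∧
    ∀ m < e + 1,
      Nat.count (fun i => Covered R m p.unpair.1 (bitString p i)) (2 ^ p) * 2 ^ e ≤ 2 ^ p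

/-- The `e`-th requirement acts at stage `p`. -/
def Acts (R : ℕ × ℕ → List Bool → Prop) (e p : ℕ) : Prop :=
  Candidate R e p ∧ ∀ q < p, ¬Candidate R e q

open Classical in
/-- The numbers enumerated into `A` before stage `t`. -/
noncomputable def stageList (R : ℕ × ℕ → List Bool → Prop) (t : ℕ) : List ℕ :=
  (List.range t).filter fun x => ∃ p < t, ∃ e < t, Acts R e p ∧ p.unpair.1 = x

open Classical in
/-- The set of all numbers with which some requirement acts. -/
noncomputable def enumeratedSet (R : ℕ × ℕ → List Bool → Prop) : Cantor :=
  fun x => decide (∃ e p, Acts R e p ∧ p.unpair.1 = x)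

section Construction

variable {R : ℕ × ℕ → List Bool → Prop} {Θ : ℕ → List Bool → List Bool → Prop}

/-- Only the first candidate stage counts. Coinfiniteness and the measure bound for the test both
rest on this. -/
theorem Acts.unique {e p q : ℕ} (hp : Acts R e p) (hq : Acts R e q) : p = q := by
  rcases lt_trichotomy p q with h | h | h
  · exact absurd hp.1 (hq.2 p h)
  · exact h
  · exact absurd hq.1 (hp.2 q h)

/-- From `2e ≤ x ≤ ⟨x, s⟩ = p`. It makes searches for acting requirements bounded. -/
theorem Acts.le {e p : ℕ} (h : Acts R e p) : e ≤ p := by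
  have h1 := h.1.2.1
  have h2 := Nat.unpair_left_le p
  lia

theorem exists_acts {e p : ℕ} (h : Candidate R e p) : ∃ q, Acts R e q := by
  classical
  exact ⟨Nat.find ⟨p, h⟩, Nat.find_spec ⟨p, h⟩, fun q hq => Nat.find_min ⟨p, h⟩ hq⟩

theorem mem_stageList {t x : ℕ} :
    x ∈ stageList R t ↔ ∃ e p, Acts R e p ∧ p.unpair.1 = x ∧ p < t := by
  simp only [stageList, List.mem_filter, List.mem_range, decide_eq_true_eq]
  constructor
  · rintro ⟨_, p, hp, e, _, h, hx⟩
    exact ⟨e, p, h, hx, hp⟩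
  · rintro ⟨e, p, h, hx, hp⟩
    have := Nat.unpair_left_le p
    exact ⟨by lia, p, hp, e, h.le.trans_lt hp, h, hx⟩

theorem enumeratedSet_eq_true {x : ℕ} :
    enumeratedSet R x = true ↔ ∃ e p, Acts R e p ∧ p.unpair.1 = x := by
  simp [enumeratedSet]

/-! ### Computability of the construction -/

theorem computablePred_covered (hR : ComputablePred fun p : (ℕ × ℕ) × List Bool => R p.1 p.2) :
    ComputablePred fun x : (ℕ × ℕ) × List Bool => Covered R x.1.1 x.1.2 x.2 := by
  refine ComputablePred.forall_lt ?_ (Computable.succ.comp (Computable.snd.comp Computable.fst))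
  refine ComputablePred.exists_lt
    (p := fun (y : ((ℕ × ℕ) × List Bool) × ℕ) l => R (y.1.1.1, y.2) (y.1.2.take l)) ?_
    (Computable.succ.comp (Computable.list_length.comp (Computable.snd.comp Computable.fst)))
  exact ComputablePred.comp hR (f := fun z : (((ℕ × ℕ) × List Bool) × ℕ) × ℕ =>
    ((z.1.1.1.1, z.1.2), z.1.1.2.take z.2))
    (((Computable.fst.comp (Computable.fst.comp (Computable.fst.comp Computable.fst))).pair
      (Computable.snd.comp Computable.fst)).pair
      (computable_take.comp Computable.snd
        (Computable.snd.comp (Computable.fst.comp Computable.fst))))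

theorem computablePred_unrefuted
    (hΘ : ComputablePred fun p : ℕ × List Bool × List Bool => Θ p.1 p.2.1 p.2.2) (k : ℕ) :
    ComputablePred fun x : List Bool × List Bool => Unrefuted Θ k x.1 x.2 := by
  refine ComputablePred.forall_lt
    (p := fun (x : List Bool × List Bool) l => Θ k (x.1.take l) (x.2.take l)) ?_
    (Computable.succ.comp (Computable.list_length.comp Computable.snd))
  exact ComputablePred.comp hΘ (f := fun z : (List Bool × List Bool) × ℕ =>
    (k, z.1.1.take z.2, z.1.2.take z.2))
    ((Computable.const k).pair
      ((computable_take.comp Computable.snd (Computable.fst.comp Computable.fst)).pair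
        (computable_take.comp Computable.snd (Computable.snd.comp Computable.fst))))

theorem computablePred_mem_wStage :
    ComputablePred fun x : (ℕ × ℕ) × ℕ => x.2 ∈ WStage x.1.1 x.1.2 := by
  have h : Computable fun x : (ℕ × ℕ) × ℕ => (Nat.Partrec.Code.evaln x.1.2
      (Denumerable.ofNat Nat.Partrec.Code x.1.1) x.2).isSome :=
    (Primrec.option_isSome.comp (Nat.Partrec.Code.primrec_evaln.comp
      (((Primrec.snd.comp Primrec.fst).pair
        ((Primrec.ofNat _).comp (Primrec.fst.comp Primrec.fst))).pair Primrec.snd))).to_comp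
  exact ComputablePred.computable_iff.2 ⟨_, h, rfl⟩

theorem computablePred_candidate
    (hR : ComputablePred fun p : (ℕ × ℕ) × List Bool => R p.1 p.2) :
    ComputablePred fun x : ℕ × ℕ => Candidate R x.1 x.2 := by
  classical
  have cp : Computable fun x : ℕ × ℕ => x.2.unpair := Computable.unpair.comp Computable.snd
  have c1 : Computable fun x : ℕ × ℕ => x.2.unpair.1 := Computable.fst.comp cp
  have c2 : Computable fun x : ℕ × ℕ => x.2.unpair.2 := Computable.snd.comp cp
  have h1 := ComputablePred.comp computablePred_mem_wStage ((Computable.fst.pair c2).pair c1)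
  have h2 := ComputablePred.comp computablePred_mem_wStage
    ((Computable.fst.pair (Computable.pred.comp c2)).pair c1)
  have h3 : ComputablePred fun x : ℕ × ℕ => 2 * x.1 ≤ x.2.unpair.1 :=
    ComputablePred.le (Primrec.nat_mul.to_comp.comp (Computable.const 2) Computable.fst) c1
  have h4 : ComputablePred fun x : ℕ × ℕ => ∀ m < x.1 + 1,
      Nat.count (fun i => Covered R m x.2.unpair.1 (bitString x.2 i)) (2 ^ x.2) * 2 ^ x.1 ≤
        2 ^ x.2 := by
    refine ComputablePred.forall_lt (p := fun (x : ℕ × ℕ) m =>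
      Nat.count (fun i => Covered R m x.2.unpair.1 (bitString x.2 i)) (2 ^ x.2) * 2 ^ x.1 ≤
        2 ^ x.2) ?_ (Computable.succ.comp Computable.fst)
    have c3 : Computable fun y : (ℕ × ℕ) × ℕ => 2 ^ y.1.2 :=
      computable_two_pow.comp (Computable.snd.comp Computable.fst)
    have c4 : Computable fun y : (ℕ × ℕ) × ℕ => 2 ^ y.1.1 :=
      computable_two_pow.comp (Computable.fst.comp Computable.fst)
    have h5 := ComputablePred.comp (computablePred_covered hR)
      (f := fun z : ((ℕ × ℕ) × ℕ) × ℕ => ((z.1.2, z.1.1.2.unpair.1), bitString z.1.1.2 z.2))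
      (((Computable.snd.comp Computable.fst).pair
        (c1.comp (Computable.fst.comp Computable.fst))).pair
        (computable_bitString.comp
          (Computable.snd.comp (Computable.fst.comp Computable.fst)) Computable.snd))
    have c5 := Computable.count (p := fun (y : (ℕ × ℕ) × ℕ) i =>
      Covered R y.2 y.1.2.unpair.1 (bitString y.1.2 i)) c3 h5
    exact ComputablePred.le (Primrec.nat_mul.to_comp.comp c5 c4) c3
  exact (ComputablePred.and (ComputablePred.and h1 h2.not) (ComputablePred.and h3 h4)).of_eq
    fun x => Iff.rfl

theorem computablePred_acts
    (hR : ComputablePred fun p : (ℕ × ℕ) × List Bool => R p.1 p.2) :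
    ComputablePred fun x : ℕ × ℕ => Acts R x.1 x.2 := by
  have h := computablePred_candidate hR
  refine ComputablePred.and h (ComputablePred.forall_lt
    (p := fun (x : ℕ × ℕ) q => ¬Candidate R x.1 q) ?_ Computable.snd)
  exact (ComputablePred.comp h (f := fun y : (ℕ × ℕ) × ℕ => (y.1.1, y.2))
    ((Computable.fst.comp Computable.fst).pair Computable.snd)).not

theorem computable_stageList
    (hR : ComputablePred fun p : (ℕ × ℕ) × List Bool => R p.1 p.2) :
    Computable (stageList R) := by
  classical
  have h := computablePred_acts hR
  refine Computable.filter_range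
    (p := fun t x => ∃ p < t, ∃ e < t, Acts R e p ∧ p.unpair.1 = x) Computable.id ?_
  refine ComputablePred.exists_lt (p := fun (y : ℕ × ℕ) p =>
    ∃ e < y.1, Acts R e p ∧ p.unpair.1 = y.2) ?_ Computable.fst
  refine ComputablePred.exists_lt (p := fun (z : (ℕ × ℕ) × ℕ) e =>
    Acts R e z.2 ∧ z.2.unpair.1 = z.1.2) ?_ (Computable.fst.comp Computable.fst)
  refine ComputablePred.and (ComputablePred.comp h (f := fun w : ((ℕ × ℕ) × ℕ) × ℕ =>
    (w.2, w.1.2)) (Computable.snd.pair (Computable.snd.comp Computable.fst))) ?_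
  exact ComputablePred.eq
    (Computable.fst.comp (Computable.unpair.comp (Computable.snd.comp Computable.fst)))
    (Computable.snd.comp (Computable.fst.comp Computable.fst))

theorem isComputableEnumeration_stageList
    (hR : ComputablePred fun p : (ℕ × ℕ) × List Bool => R p.1 p.2) :
    IsComputableEnumeration (enumeratedSet R) (stageList R) := by
  refine ⟨computable_stageList hR, fun s x hx => ?_, fun x => ?_⟩
  · obtain ⟨e, p, h, hx, hp⟩ := mem_stageList.1 hx
    exact mem_stageList.2 ⟨e, p, h, hx, hp.trans s.lt_succ_self⟩
  · rw [enumeratedSet_eq_true]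
    constructor
    · rintro ⟨e, p, h, hx⟩
      exact ⟨p + 1, mem_stageList.2 ⟨e, p, h, hx, p.lt_succ_self⟩⟩
    · rintro ⟨s, hs⟩
      obtain ⟨e, p, h, hx, _⟩ := mem_stageList.1 hs
      exact ⟨e, p, h, hx⟩

theorem rePred_enumeratedSet
    (hR : ComputablePred fun p : (ℕ × ℕ) × List Bool => R p.1 p.2) :
    REPred fun n => enumeratedSet R n = true :=
  (REPred.exists_nat (p := fun n s => n ∈ stageList R s)
    (ComputablePred.mem_list Computable.fst
      ((computable_stageList hR).comp Computable.snd))).of_eq fun n =>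
    ((isComputableEnumeration_stageList hR).2.2 n).symm

/-- A number below `2e` can be enumerated only by a requirement `d < e`, and each contributes at
most one number. So at least `e` numbers below `2e` stay out of the set, for every `e`. -/
theorem infinite_compl_enumeratedSet : {n : ℕ | enumeratedSet R n = false}.Infinite := by
  classical
  intro hfin
  set F := hfin.toFinset
  set e := F.card + 1
  -- The number contributed by requirement `d`; the default `0` can only enlarge the image, which is
  -- harmless for the cardinality bound.
  let g : ℕ → ℕ := fun d => if h : ∃ p, Acts R d p then h.choose.unpair.1 else 0
  have hsub : Finset.range (2 * e) ⊆ F ∪ (Finset.range e).image g := by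
    intro x hx
    rw [Finset.mem_range] at hx
    rw [Finset.mem_union, Finset.mem_image]
    cases hA : enumeratedSet R x with
    | false => exact Or.inl (hfin.mem_toFinset.2 hA)
    | true =>
      right
      obtain ⟨d, p, h, hpx⟩ := enumeratedSet_eq_true.1 hA
      refine ⟨d, ?_, ?_⟩
      · have := h.1.2.1
        rw [Finset.mem_range]; lia
      · have hex : ∃ p, Acts R d p := ⟨p, h⟩
        simp only [g, dif_pos hex]
        rw [hex.choose_spec.unique h, hpx]
  have h1 := Finset.card_le_card hsub
  have h2 := Finset.card_union_le F ((Finset.range e).image g)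
  have h3 := Finset.card_image_le (s := Finset.range e) (f := g)
  simp only [Finset.card_range] at h1 h3
  lia

/-! ### Shrinking of the approximating classes, and prompt simplicity -/

theorem Covered.mono_left {m x y : ℕ} {σ : List Bool} (h : Covered R m x σ) (hxy : y ≤ x) :
    Covered R m y σ := fun i hi => h i (by lia)

theorem covered_restrict {m x s : ℕ} {X : Cantor} :
    Covered R m x (restrict X s) ↔ ∀ i ≤ x, ∃ l ≤ s, R (m, i) (restrict X l) := by
  simp only [Covered, length_restrict, Nat.lt_succ_iff]
  refine forall₂_congr fun i _ => exists_congr fun l => and_congr_right fun hl => ?_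
  rw [take_restrict X hl]

theorem unrefuted_restrict {k s : ℕ} {X Y : Cantor} :
    Unrefuted Θ k (restrict Y s) (restrict X s) ↔
      ∀ l ≤ s, Θ k (restrict Y l) (restrict X l) := by
  simp only [Unrefuted, length_restrict, Nat.lt_succ_iff]
  refine forall₂_congr fun l hl => ?_
  rw [take_restrict X hl, take_restrict Y hl]

theorem monotone_covered (m x : ℕ) (X : Cantor) :
    Monotone fun s => Covered R m x (restrict X s) := by
  intro s t hst h
  simp only [covered_restrict] at h ⊢
  intro i hi
  obtain ⟨l, hl, hR⟩ := h i hi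
  exact ⟨l, hl.trans hst, hR⟩

/-- The `Σ⁰₁` class of which `Covered R m x` gives the finite stages. -/
theorem exists_covered_iff {m x : ℕ} {X : Cantor} :
    (∃ s, Covered R m x (restrict X s)) ↔ ∀ i ≤ x, ∃ l, R (m, i) (restrict X l) := by
  constructor
  · rintro ⟨s, hs⟩ i hi
    obtain ⟨l, _, h⟩ := covered_restrict.1 hs i hi
    exact ⟨l, h⟩
  · intro h
    choose! l hl using h
    refine ⟨(Finset.range (x + 1)).sup l, covered_restrict.2 fun i hi => ⟨l i, ?_, hl i hi⟩⟩
    exact Finset.le_sup (f := l) (Finset.mem_range.2 (Nat.lt_succ_of_le hi))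

theorem measurableSet_exists_covered (m x : ℕ) :
    MeasurableSet {X : Cantor | ∃ s, Covered R m x (restrict X s)} := by
  have : {X : Cantor | ∃ s, Covered R m x (restrict X s)} =
      ⋃ s, {X : Cantor | Covered R m x (restrict X s)} := by ext; simp
  rw [this]
  exact MeasurableSet.iUnion fun s => measurableSet_restrict _ s

/-- Continuity from above: the classes decrease in `x` and their intersection is the null class `S`.
-/
theorem tendsto_coinMeasure_covered {S : Set Cantor} {m : ℕ}
    (hS : ∀ X, X ∈ S ↔ ∀ i, ∃ l, R (m, i) (restrict X l)) (h0 : coinMeasure S = 0) :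
    Tendsto (fun x => coinMeasure {X | ∃ s, Covered R m x (restrict X s)}) atTop (𝓝 0) := by
  have hinter : S = ⋂ x, {X : Cantor | ∃ s, Covered R m x (restrict X s)} := by
    ext X
    simp only [hS, Set.mem_iInter, Set.mem_ofPred_eq, exists_covered_iff]
    exact ⟨fun h x i _ => h i, fun h i => h i i le_rfl⟩
  rw [← h0, hinter]
  refine tendsto_measure_iInter_atTop
    (fun x => (measurableSet_exists_covered m x).nullMeasurableSet) ?_ ⟨0, measure_ne_top _ _⟩
  intro x y hxy X hX
  obtain ⟨s, hs⟩ := hX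
  exact ⟨s, hs.mono_left hxy⟩

theorem candidate_iff {e p : ℕ} : Candidate R e p ↔
    p.unpair.1 ∈ WStage e p.unpair.2 \ WStage e (p.unpair.2 - 1) ∧ 2 * e ≤ p.unpair.1 ∧
      ∀ m ≤ e, coinMeasure {X | Covered R m p.unpair.1 (restrict X p)} ≤ (2⁻¹ : ENNReal) ^ e := by
  simp only [Candidate, coinMeasure_restrict_le_iff, Nat.lt_succ_iff]

theorem exists_first_stage {e n : ℕ} (h : n ∈ W e) :
    ∃ s, n ∈ WStage e s \ WStage e (s - 1) := by
  classical
  have hex : ∃ s, n ∈ WStage e s := by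
    obtain ⟨y, hy⟩ := Part.dom_iff_mem.1 h
    obtain ⟨s, hs⟩ := Nat.Partrec.Code.evaln_complete.1 hy
    exact ⟨s, Option.isSome_iff_exists.2 ⟨y, hs⟩⟩
  refine ⟨Nat.find hex, Nat.find_spec hex, fun hpred => ?_⟩
  rcases Nat.eq_zero_or_pos (Nat.find hex) with h0 | hpos
  · rw [h0] at hpred
    obtain ⟨y, hy⟩ := Option.isSome_iff_exists.1 hpred
    exact absurd (Nat.Partrec.Code.evaln_bound hy) (Nat.not_lt_zero n)
  · exact Nat.find_min hex (Nat.sub_lt hpos one_pos) hpred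

theorem lt_of_mem_wStage {e s n : ℕ} (h : n ∈ WStage e s) : n < s := by
  obtain ⟨y, hy⟩ := Option.isSome_iff_exists.1 h
  exact Nat.Partrec.Code.evaln_bound hy

/-- A large `x` in `W e` makes the full `Σ⁰₁` classes for all `m ≤ e` smaller than `2⁻ᵉ`. Their
finite stages are smaller still, so `x` is affordable at whatever stage it appears. -/
theorem exists_candidate {e : ℕ} (hlim : ∀ m, Tendsto
      (fun x => coinMeasure {X | ∃ s, Covered R m x (restrict X s)}) atTop (𝓝 0))
    (hW : (W e).Infinite) : ∃ p, Candidate R e p := by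
  have hev : ∀ᶠ x in atTop, ∀ m ∈ Finset.range (e + 1),
      coinMeasure {X | ∃ s, Covered R m x (restrict X s)} < (2⁻¹ : ENNReal) ^ e := by
    refine (Finset.eventually_all _).2 fun m _ => (hlim m).eventually_lt_const ?_
    exact ENNReal.pow_pos (by simp) e
  obtain ⟨x, hx, h2, hm⟩ := ((Nat.frequently_atTop_iff_infinite.2 hW).and_eventually
    ((eventually_ge_atTop (2 * e)).and hev)).exists
  obtain ⟨s, hs⟩ := exists_first_stage hx
  refine ⟨Nat.pair x s, candidate_iff.2 ?_⟩
  rw [Nat.unpair_pair]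
  refine ⟨hs, h2, fun m hme => ?_⟩
  refine le_trans (measure_mono fun X hX => ?_)
    (hm m (Finset.mem_range.2 (Nat.lt_succ_of_le hme))).le
  exact ⟨_, hX⟩

theorem isPromptlySimple_enumeratedSet
    (hR : ComputablePred fun p : (ℕ × ℕ) × List Bool => R p.1 p.2)
    (hlim : ∀ m, Tendsto
      (fun x => coinMeasure {X | ∃ s, Covered R m x (restrict X s)}) atTop (𝓝 0)) :
    IsPromptlySimple (enumeratedSet R) := by
  -- An element `x` entering at stage `s` satisfies `x < s`, so its action stage `⟨x, s⟩` is below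
  -- `(s + 1)²`.
  refine ⟨rePred_enumeratedSet hR, infinite_compl_enumeratedSet, fun s => (s + 1) * (s + 1),
    stageList R, Primrec.nat_mul.to_comp.comp Computable.succ Computable.succ,
    isComputableEnumeration_stageList hR, fun e hW => ?_⟩
  obtain ⟨p, hp⟩ := exists_candidate hlim hW
  -- The first candidate may involve another number than `p` does, but it too has just entered `W
  -- e`.
  obtain ⟨q, hq⟩ := exists_acts hp
  refine ⟨q.unpair.1, q.unpair.2, hq.1.1, mem_stageList.2 ⟨e, q, hq, rfl, ?_⟩⟩
  have h1 := lt_of_mem_wStage hq.1.1.1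
  have h2 := Nat.pair_lt_max_add_one_sq q.unpair.1 q.unpair.2
  rwa [Nat.pair_unpair, max_eq_right h1.le, sq] at h2

/-! ### The Martin-Löf test charged by the enumeration -/

/-- The Martin-Löf test consisting of the classes `V (m, x)` at the stages when `x` is enumerated,
for all requirements from the `(n + 1 + m)`-th on. -/
def enumerationTest (R : ℕ × ℕ → List Bool → Prop) (m n : ℕ) : Set Cantor :=
  {X | ∃ e p, n + 1 + m ≤ e ∧ Acts R e p ∧ Covered R m p.unpair.1 (restrict X p)}

/-- Each `e ≥ m` acts at most once and then contributes measure at most `2⁻ᵉ`. In the threshold `n +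
1 + m`, the summand `m` ensures that the `m`-th class was among those checked, and `n + 1` makes the
geometric tail sum to `2⁻ⁿ`. -/
theorem coinMeasure_enumerationTest_le (m n : ℕ) :
    coinMeasure (enumerationTest R m n) ≤ (2⁻¹ : ENNReal) ^ n := by
  have hsub : enumerationTest R m n ⊆ ⋃ j : ℕ, {X | ∃ p, Acts R (n + 1 + j) p ∧
      m ≤ n + 1 + j ∧ Covered R m p.unpair.1 (restrict X p)} := by
    rintro X ⟨e, p, he, hp, hX⟩
    refine Set.mem_iUnion.2 ⟨e - (n + 1), p, ?_, by lia, hX⟩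
    rwa [show n + 1 + (e - (n + 1)) = e by lia]
  have hterm : ∀ j : ℕ, coinMeasure {X | ∃ p, Acts R (n + 1 + j) p ∧
      m ≤ n + 1 + j ∧ Covered R m p.unpair.1 (restrict X p)} ≤ (2⁻¹ : ENNReal) ^ (n + 1 + j) := by
    intro j
    by_cases h : ∃ p, Acts R (n + 1 + j) p ∧ m ≤ n + 1 + j
    · obtain ⟨p, hp, hm⟩ := h
      refine le_trans (measure_mono ?_) ((candidate_iff.1 hp.1).2.2 m hm)
      rintro X ⟨q, hq, _, hX⟩
      rwa [hq.unique hp] at hX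
    · have : {X | ∃ p, Acts R (n + 1 + j) p ∧
          m ≤ n + 1 + j ∧ Covered R m p.unpair.1 (restrict X p)} = ∅ :=
        Set.eq_empty_of_forall_notMem fun X ⟨p, hp, hm, _⟩ => h ⟨p, hp, hm⟩
      rw [this, measure_empty]
      exact zero_le
  calc coinMeasure (enumerationTest R m n)
      ≤ ∑' j : ℕ, (2⁻¹ : ENNReal) ^ (n + 1 + j) :=
        (measure_mono hsub).trans ((measure_iUnion_le _).trans (ENNReal.tsum_le_tsum hterm))
    _ = (2⁻¹ : ENNReal) ^ n := by
        simp only [pow_add _ (n + 1), ENNReal.tsum_mul_left, ENNReal.tsum_geometric,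
          ENNReal.one_sub_inv_two, inv_inv]
        rw [pow_succ, mul_assoc, ENNReal.inv_mul_cancel (by simp) (by simp), mul_one]

theorem uniformlySigma01_enumerationTest
    (hR : ComputablePred fun p : (ℕ × ℕ) × List Bool => R p.1 p.2) (m : ℕ) :
    UniformlySigma01 (enumerationTest R m) := by
  refine ⟨fun n σ => ∃ e < σ.length + 1, ∃ p < σ.length + 1, n + 1 + m ≤ e ∧ Acts R e p ∧
    Covered R m p.unpair.1 (σ.take p), ?_, fun n X => ?_⟩
  · refine ComputablePred.exists_lt (p := fun (x : ℕ × List Bool) e =>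
      ∃ p < x.2.length + 1, x.1 + 1 + m ≤ e ∧ Acts R e p ∧
        Covered R m p.unpair.1 (x.2.take p)) ?_
      (Computable.succ.comp (Computable.list_length.comp Computable.snd))
    refine ComputablePred.exists_lt (p := fun (x : (ℕ × List Bool) × ℕ) p =>
      x.1.1 + 1 + m ≤ x.2 ∧ Acts R x.2 p ∧ Covered R m p.unpair.1 (x.1.2.take p)) ?_
      (Computable.succ.comp (Computable.list_length.comp (Computable.snd.comp Computable.fst)))
    refine ComputablePred.and (ComputablePred.le
      (Primrec.nat_add.to_comp.comp (Computable.succ.comp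
        (Computable.fst.comp (Computable.fst.comp Computable.fst))) (Computable.const m))
      (Computable.snd.comp Computable.fst)) (ComputablePred.and ?_ ?_)
    · exact ComputablePred.comp (computablePred_acts hR)
        ((Computable.snd.comp Computable.fst).pair Computable.snd)
    · exact ComputablePred.comp (computablePred_covered hR)
        (f := fun x : ((ℕ × List Bool) × ℕ) × ℕ =>
          ((m, x.2.unpair.1), x.1.1.2.take x.2))
        (((Computable.const m).pair (Computable.fst.comp
          (Computable.unpair.comp Computable.snd))).pair
          (computable_take.comp Computable.snd
            (Computable.snd.comp (Computable.fst.comp Computable.fst))))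
  · simp only [length_restrict, Nat.lt_succ_iff]
    constructor
    · rintro ⟨e, p, he, hp, hX⟩
      -- The length `p` suffices as witness because `e ≤ p`.
      exact ⟨p, e, hp.le, p, le_rfl, he, hp, by rwa [take_restrict X le_rfl]⟩
    · rintro ⟨l, e, _, p, hpl, he, hp, hX⟩
      exact ⟨e, p, he, hp, by rwa [take_restrict X hpl] at hX⟩

/-- Finitely many requirements act at most once each. The bound need not be computable from `N`: the
reduction uses a single value as a constant. -/
theorem exists_stage_bound (R : ℕ × ℕ → List Bool → Prop) (N : ℕ) :
    ∃ b, ∀ e < N, ∀ p, Acts R e p → p < b := by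
  classical
  induction N with
  | zero => exact ⟨0, by simp⟩
  | succ N ih =>
    obtain ⟨b, hb⟩ := ih
    by_cases h : ∃ q, Acts R N q
    · obtain ⟨q, hq⟩ := h
      refine ⟨max b (q + 1), fun e he p hp => ?_⟩
      rcases Nat.lt_succ_iff_lt_or_eq.1 he with he | rfl
      · exact lt_max_of_lt_left (hb e he p hp)
      · exact lt_max_of_lt_right (by rw [hp.unique hq]; exact q.lt_succ_self)
    · refine ⟨b, fun e he p hp => ?_⟩
      rcases Nat.lt_succ_iff_lt_or_eq.1 he with he | rfl
      · exact hb e he p hp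
      · exact absurd ⟨p, hp⟩ h

/-! ### The reduction to members of the class `𝒟` -/

theorem turingLE_enumeratedSet
    (hR : ComputablePred fun p : (ℕ × ℕ) × List Bool => R p.1 p.2)
    (hΘ : ComputablePred fun p : ℕ × List Bool × List Bool => Θ p.1 p.2.1 p.2.2)
    {k m : ℕ} {Y Z : Cantor} (hZ : IsOneRandom Z)
    (hYZ : ∀ l, Θ k (restrict Y l) (restrict Z l))
    (hsub : ∀ X, (∀ l, Θ k (restrict Y l) (restrict X l)) → ∀ i, ∃ l, R (m, i) (restrict X l)) :
    TuringLE (enumeratedSet R) Y := by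
  have hpass := hZ _ ⟨uniformlySigma01_enumerationTest hR m, coinMeasure_enumerationTest_le m⟩
  obtain ⟨n, hn⟩ := not_forall.1 (mt Set.mem_iInter.2 hpass)
  obtain ⟨b, hb⟩ := exists_stage_bound R (n + 1 + m)
  -- Actions from stage `b` on belong to requirements counted in the `n`-th test class, which `Z`
  -- avoids.
  have hlate : ∀ e p, Acts R e p → b ≤ p → ¬Covered R m p.unpair.1 (restrict Z p) :=
    fun e p hp hbp hcov => hn
      ⟨e, p, not_lt.1 fun h => (hb e h p hp).not_ge hbp, hp, hcov⟩
  refine turingLE_of_search (C := fun x s τ => ∀ i < 2 ^ s,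
      Unrefuted Θ k τ (bitString s i) → Covered R m x (bitString s i))
    (D := fun x s => x ∈ stageList R (max b s)) ?_ ?_ (fun x => ?_) (fun x s hs => ?_)
  · refine ComputablePred.forall_lt (p := fun (y : (ℕ × ℕ) × List Bool) i =>
      Unrefuted Θ k y.2 (bitString y.1.2 i) → Covered R m y.1.1 (bitString y.1.2 i)) ?_
      (computable_two_pow.comp (Computable.snd.comp Computable.fst))
    have hstr : Computable fun z : ((ℕ × ℕ) × List Bool) × ℕ => bitString z.1.1.2 z.2 :=
      computable_bitString.comp (Computable.snd.comp (Computable.fst.comp Computable.fst))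
        Computable.snd
    refine ComputablePred.imp ?_ ?_
    · exact ComputablePred.comp (computablePred_unrefuted hΘ k)
        ((Computable.snd.comp Computable.fst).pair hstr)
    · exact ComputablePred.comp (computablePred_covered hR)
        (((Computable.const m).pair
          (Computable.fst.comp (Computable.fst.comp Computable.fst))).pair hstr)
  · exact ComputablePred.mem_list Computable.fst ((computable_stageList hR).comp
      (Primrec.nat_max.to_comp.comp (Computable.const b) Computable.snd))
  -- The search halts by compactness, since `P k Y` lies inside the `Σ⁰₁` class approximated by
  -- `Covered R m x`.
  · obtain ⟨s, hs⟩ := exists_stage_subset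
      (C := fun s σ => Unrefuted Θ k (restrict Y s) σ) (V := fun _ σ => Covered R m x σ)
      (fun X s t hst h => unrefuted_restrict.2 fun l hl =>
        unrefuted_restrict.1 h l (hl.trans hst))
      (fun X => monotone_covered m x X)
      (fun X hX => exists_covered_iff.2 fun i _ =>
        hsub X (fun l => unrefuted_restrict.1 (hX l) l le_rfl) i)
    exact ⟨s, fun i _ h => hs _ h⟩
  -- The reduction never knows `Z`: the condition holds for all unrefuted strings of length `s`, and
  -- `Z` restricted to `s` is one of them.
  · obtain ⟨i, hi, hiZ⟩ := exists_bitString_eq Z s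
    have hcov : Covered R m x (restrict Z s) := by
      rw [← hiZ]
      refine hs i hi ?_
      rw [hiZ]
      exact unrefuted_restrict.2 fun l _ => hYZ l
    rw [enumeratedSet_eq_true, mem_stageList]
    constructor
    · rintro ⟨e, p, hp, rfl⟩
      refine ⟨e, p, hp, rfl, not_le.1 fun hle => ?_⟩
      -- `Z` is covered at `s`, hence at every later stage, so an action with this number at a stage
      -- `p ≥ max b s` would capture `Z`.
      exact hlate e p hp ((le_max_left b s).trans hle)
        (monotone_covered m _ Z ((le_max_right b s).trans hle) hcov)
    · rintro ⟨e, p, hp, hx, _⟩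
      exact ⟨e, p, hp, hx⟩

end Construction

end AlgRandom

theorem mainTheorem5
    (S : ℕ → Set AlgRandom.Cantor)
    (P : ℕ → AlgRandom.Cantor → AlgRandom.Cantor → Prop)
    (hS : AlgRandom.UniformlyPi02 S)
    (hS0 : ∀ m : ℕ, AlgRandom.coinMeasure (S m) = 0)
    (hP : AlgRandom.UniformlyPi01Rel P) :
    ∃ A : AlgRandom.Cantor, AlgRandom.IsPromptlySimple A ∧
      ∀ Y ∈ AlgRandom.classD S P, AlgRandom.TuringLE A Y := by
  obtain ⟨V, ⟨R, hR, hVR⟩, hSV⟩ := hS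
  obtain ⟨Θ, hΘ, hPΘ⟩ := hP
  have hSR : ∀ m X, X ∈ S m ↔ ∀ i, ∃ l, R (m, i) (AlgRandom.restrict X l) := fun m X => by
    rw [hSV, Set.mem_iInter]
    exact forall_congr' fun i => hVR (m, i) X
  refine ⟨AlgRandom.enumeratedSet R, AlgRandom.isPromptlySimple_enumeratedSet hR fun m =>
    AlgRandom.tendsto_coinMeasure_covered (hSR m) (hS0 m), ?_⟩
  rintro Y ⟨k, m, Z, hZ, hYZ, hsub⟩
  exact AlgRandom.turingLE_enumeratedSet hR hΘ hZ ((hPΘ k Y Z).1 hYZ)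
    fun X hX => (hSR m X).1 (hsub ((hPΘ k Y X).2 hX))
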